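/- Let $k:\mathbb{R}^d\times\mathbb{R}^d\to\mathbb{R}$ be a symmetric positive definite kernel (all finite Gram matrices are symmetric and positive semidefinite), with reproducing kernel Hilbert space $H$. For a finite sequence $\mathbf{x}=(\mathbf{x}_1,\dots,\mathbf{x}_{L_{\mathbf{x}}})$ in $\mathbb{R}^d$, $L_{\mathbf{x}}\ge 1$, let $k_{\mathbf{x}}:[0,L_{\mathbf{x}}-1]\to H$ be the piecewise linear path with vertices $k(\mathbf{x}_1,\cdot),\dots,k(\mathbf{x}_{L_{\mathbf{x}}},\cdot)$, that is, $k_{\mathbf{x}}(t)=(i-t)\,k(\mathbf{x}_{i},\cdot)+(t-i+1)\,k(\mathbf{x}_{i+1},\cdot)$ for $t\in[i-1,i]$ and $1\le i<L_{\mathbf{x}}$. For $M\in\mathbb{N}=\{0,1,2,\dots\}$ let $$\mathrm{Sig}_{:M}(k_{\mathbf{x}})=\Bigl(1,\int dk_{\mathbf{x}},\dots,\int dk_{\mathbf{x}}^{\otimes M},0,0,\dots\Bigr)\in\prod_{m\ge 0}H^{\otimes m},\qquad \int dk_{\mathbf{x}}^{\otimes m}=\int_{0<t_1<\cdots<t_m<L_{\mathbf{x}}-1}dk_{\mathbf{x}}(t_1)\otimes\cdots\otimes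 dk_{\mathbf{x}}(t_m),$$ where $H^{\otimes m}$ is the Hilbert space tensor power ($H^{\otimes 0}=\mathbb{R}$), and let $$k_{\mathsf{Sig},:M}(\mathbf{x},\mathbf{y})=\langle \mathrm{Sig}_{:M}(k_{\mathbf{x}}),\mathrm{Sig}_{:M}(k_{\mathbf{y}})\rangle=\sum_{m=0}^{M}\Bigl\langle \int dk_{\mathbf{x}}^{\otimes m},\int dk_{\mathbf{y}}^{\otimes m}\Bigr\rangle_{H^{\otimes m}}.$$ Theorem. There are a single algorithm and an absolute constant $C$ such that for all $d$, all such kernels $k$, all $M\in\mathbb{N}$ and all sequences $\mathbf{x}$, $\mathbf{y}$ in $\mathbb{R}^d$ of lengths $L_{\mathbf{x}},L_{\mathbf{y}}\ge 1$, the algorithm, given $M$, $L_{\mathbf{x}}$, $L_{\mathbf{y}}$ and access to the Gram entries $k(\mathbf{x}_i,\mathbf{y}_j)$, returns exactly $k_{\mathsf{Sig},:M}(\mathbf{x},\mathbf{y})$ after at most $C\max(M,1)^3L^2$ steps, where $L=\max(L_{\mathbf{x}},L_{\mathbf{y}})$. Here an algorithm is a program with exact real arithmetic at unit cost: reading a Gram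 entry, an access to a variable or an array entry, an addition, subtraction or multiplication of reals, a division of a real by a natural number, an addition, subtraction or comparison of indices, an assignment and a loop iteration each count as a step. -/

import Mathlib

open scoped TensorProduct

/-! ### Kernels and their reproducing kernel Hilbert spaces -/

/-- A (symmetric, positive definite) kernel on `X`: every finite Gram matrix is symmetric and
positive semidefinite. -/
def IsPosDefKernel {X : Type} (k : X → X → ℝ) : Prop :=
  (∀ x y, k x y = k y x) ∧
    ∀ (n : ℕ) (x : Fin n → X) (c : Fin n → ℝ), 0 ≤ ∑ i, ∑ j, c i * c j * k (x i) (x j)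

/-- The kernel `k` as a matrix of operators on `ℝ`, the form in which Mathlib's `RKHS.OfKernel`
expects it. -/
noncomputable def kernelMatrix {X : Type} (k : X → X → ℝ) : Matrix X X (ℝ →L[ℝ] ℝ) :=
  Matrix.of fun x y => k x y • ContinuousLinearMap.id ℝ ℝ

theorem IsPosDefKernel.posSemidef {X : Type} {k : X → X → ℝ} (hk : IsPosDefKernel k) :
    (kernelMatrix k).PosSemidef := by
  have key := (RKHS.posSemidef_tfae (K := kernelMatrix k)).out 0 2
  refine key.mpr ⟨?_, fun f => ?_⟩
  · ext x y
    have h1 : ContinuousLinearMap.adjoint (ContinuousLinearMap.id ℝ ℝ) =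
        ContinuousLinearMap.id ℝ ℝ := star_one (ℝ →L[ℝ] ℝ)
    simp [kernelMatrix, Matrix.conjTranspose_apply, ContinuousLinearMap.star_eq_adjoint, h1,
      hk.1 x y]
  · have h := hk.2 f.support.card (fun i => (f.support.equivFin.symm i : X))
      (fun i => f (f.support.equivFin.symm i : X))
    have e : ∀ g : X → ℝ, ∑ i : Fin f.support.card, g (f.support.equivFin.symm i : X) =
        ∑ x ∈ f.support, g x := fun g => by
      rw [← Finset.sum_coe_sort f.support g]
      exact Equiv.sum_comp f.support.equivFin.symm (fun z : f.support => g z)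
    have h' : 0 ≤ ∑ x ∈ f.support, ∑ y ∈ f.support, f x * f y * k x y := by
      rw [← e]
      refine h.trans_eq (Finset.sum_congr rfl fun i _ => ?_)
      exact e (fun y => f (f.support.equivFin.symm i : X) * f y * k (f.support.equivFin.symm i) y)
    refine h'.trans_eq ?_
    simp only [Finsupp.sum, kernelMatrix, RCLike.re_to_real]
    refine Finset.sum_congr rfl fun x _ => Finset.sum_congr rfl fun y _ => ?_
    simp [hk.1 x y]
    ring

/-- The canonical feature `k(x, ·)`, an element of the reproducing kernel Hilbert space of `k`. -/
noncomputable def kernelFeature {X : Type} (k : X → X → ℝ) [Fact (kernelMatrix k).PosSemidef]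
    (x : X) : RKHS.OfKernel (kernelMatrix k) :=
  RKHS.kerFun (RKHS.OfKernel (kernelMatrix k)) x 1

/-! ### Hilbert tensor powers -/

/-- A bundled real Hilbert space. -/
structure RealHilbert where
  carrier : Type
  [grp : NormedAddCommGroup carrier]
  [inn : InnerProductSpace ℝ carrier]
  [compl : CompleteSpace carrier]

attribute [instance] RealHilbert.grp RealHilbert.inn RealHilbert.compl

section Signature

variable (H : Type) [NormedAddCommGroup H] [InnerProductSpace ℝ H]

/-- The Hilbert space `H^{⊗m}`: `H^{⊗0} = ℝ`, and `H^{⊗(m+1)}` is the completion of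
`H^{⊗m} ⊗ H` for the inner product with `⟪a ⊗ u, b ⊗ v⟫ = ⟪a, b⟫ * ⟪u, v⟫`. -/
noncomputable def tensorPow : ℕ → RealHilbert
  | 0 => { carrier := ℝ }
  | m + 1 => { carrier := UniformSpace.Completion ((tensorPow m).carrier ⊗[ℝ] H) }

variable {H}

/-- The product `a ⊗ u` in `H^{⊗(m+1)}` of `a` in `H^{⊗m}` and `u` in `H`. -/
noncomputable def tensorSnoc {m : ℕ} (a : (tensorPow H m).carrier) (u : H) :
    (tensorPow H (m + 1)).carrier :=
  ((a ⊗ₜ[ℝ] u : (tensorPow H m).carrier ⊗[ℝ] H) :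
    UniformSpace.Completion ((tensorPow H m).carrier ⊗[ℝ] H))

/-! ### Signatures -/

/-- The iterated integral `∫_{0 < t₁ < ⋯ < t_m < t} γ'(t₁) ⊗ ⋯ ⊗ γ'(t_m) dt₁ ⋯ dt_m` of an
(absolutely continuous) path `γ`. -/
noncomputable def iteratedIntegral (γ : ℝ → H) : (m : ℕ) → ℝ → (tensorPow H m).carrier
  | 0, _ => (1 : ℝ)
  | m + 1, t => ∫ s in (0 : ℝ)..t, tensorSnoc (iteratedIntegral γ m s) (deriv γ s)

/-- The signature of `γ` on `[0, T]` truncated at level `M`, as a sequence of tensors which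
vanishes beyond degree `M`. -/
noncomputable def truncSignature (M : ℕ) (T : ℝ) (γ : ℝ → H) (m : ℕ) : (tensorPow H m).carrier :=
  if m ≤ M then iteratedIntegral γ m T else 0

/-- The inner product of two sequences of tensors. -/
noncomputable def tensorInner (a b : (m : ℕ) → (tensorPow H m).carrier) : ℝ :=
  ∑' m, inner ℝ (a m) (b m)

/-- The piecewise linear path through the points `v 0, …, v (L - 1)`: for `i + 1 < L` and `t` in
`[i, i + 1]` it is at `(1 - (t - i)) v i + (t - i) v (i + 1)`. It is used on `[0, L - 1]` only. -/
noncomputable def piecewiseLinear {L : ℕ} (v : Fin L → H) (t : ℝ) : H :=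
  let w : ℕ → H := fun i => if h : i < L then v ⟨i, h⟩ else 0
  (1 - (t - ⌊t⌋₊)) • w ⌊t⌋₊ + (t - ⌊t⌋₊) • w (⌊t⌋₊ + 1)

end Signature

/-- The signature kernel truncated at level `M` of the sequences `x` and `y`: the inner product of
the truncated signatures of the piecewise linear paths through the features `k(x_i, ·)` and
`k(y_j, ·)` in the reproducing kernel Hilbert space of `k`. -/
noncomputable def truncSigKernel {X : Type} (k : X → X → ℝ) (hk : IsPosDefKernel k) (M : ℕ)
    {Lx Ly : ℕ} (x : Fin Lx → X) (y : Fin Ly → X) : ℝ :=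
  haveI : Fact (kernelMatrix k).PosSemidef := ⟨hk.posSemidef⟩
  tensorInner
    (truncSignature M ((Lx : ℝ) - 1) (piecewiseLinear fun i => kernelFeature k (x i)))
    (truncSignature M ((Ly : ℝ) - 1) (piecewiseLinear fun j => kernelFeature k (y j)))

/-! ### A model of exact computation with unit costs

Programs are written in a small imperative language with natural number variables, arrays of real
numbers, and counting loops. Every literal, variable access, array access, arithmetic operation,
assignment, test and loop iteration is a step. The only access to the data is by reading single
entries of a matrix `G` of real numbers. -/

namespace RealProgram

/-- Memory: natural number variables, and real arrays `cells a` addressed by tuples of indices. -/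
structure Store where
  vars : ℕ → ℕ
  cells : ℕ → List ℕ → ℝ

/-- Index expressions; subtraction is truncated. -/
inductive NatExpr where
  | lit (n : ℕ)
  | var (v : ℕ)
  | add (e f : NatExpr)
  | sub (e f : NatExpr)

/-- Real expressions. The only division is that by a natural number. -/
inductive RealExpr where
  | ofNat (e : NatExpr)
  | cell (a : ℕ) (idx : List NatExpr)
  | entry (i j : NatExpr)
  | add (p q : RealExpr)
  | sub (p q : RealExpr)
  | mul (p q : RealExpr)
  | div (p : RealExpr) (e : NatExpr)

/-- Programs. `loop v e c` executes `c` for `v = 0, 1, …, n - 1`, where `n` is the value of `e` on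
entry to the loop; `ifLt e f c c'` executes `c` if `e < f` and `c'` otherwise. -/
inductive Program where
  | skip
  | setVar (v : ℕ) (e : NatExpr)
  | setCell (a : ℕ) (idx : List NatExpr) (p : RealExpr)
  | seq (c c' : Program)
  | ifLt (e f : NatExpr) (c c' : Program)
  | loop (v : ℕ) (e : NatExpr) (c : Program)

def NatExpr.eval (s : Store) : NatExpr → ℕ
  | lit n => n
  | var v => s.vars v
  | add e f => e.eval s + f.eval s
  | sub e f => e.eval s - f.eval s

def NatExpr.cost : NatExpr → ℕ
  | lit _ => 1
  | var _ => 1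
  | add e f => e.cost + f.cost + 1
  | sub e f => e.cost + f.cost + 1

noncomputable def RealExpr.eval (G : ℕ → ℕ → ℝ) (s : Store) : RealExpr → ℝ
  | ofNat e => (e.eval s : ℝ)
  | cell a idx => s.cells a (idx.map (NatExpr.eval s))
  | entry i j => G (i.eval s) (j.eval s)
  | add p q => p.eval G s + q.eval G s
  | sub p q => p.eval G s - q.eval G s
  | mul p q => p.eval G s * q.eval G s
  | div p e => p.eval G s / (e.eval s : ℝ)

def RealExpr.cost : RealExpr → ℕ
  | ofNat e => e.cost + 1
  | cell _ idx => (idx.map NatExpr.cost).sum + 1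
  | entry i j => i.cost + j.cost + 1
  | add p q => p.cost + q.cost + 1
  | sub p q => p.cost + q.cost + 1
  | mul p q => p.cost + q.cost + 1
  | div p e => p.cost + e.cost + 1

/-- Assign `n` to the variable `v`. -/
def Store.setVar (s : Store) (v n : ℕ) : Store :=
  { s with vars := Function.update s.vars v n }

/-- Assign `r` to the entry with indices `idx` of the array `a`. -/
def Store.setCell (s : Store) (a : ℕ) (idx : List ℕ) (r : ℝ) : Store :=
  { s with cells := Function.update s.cells a (Function.update (s.cells a) idx r) }

/-- Execution of a program from a given store: the resulting store and the number of steps. -/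
noncomputable def Program.exec (G : ℕ → ℕ → ℝ) : Program → Store → Store × ℕ
  | skip, s => (s, 1)
  | setVar v e, s => (s.setVar v (e.eval s), e.cost + 1)
  | setCell a idx p, s =>
      (s.setCell a (idx.map (NatExpr.eval s)) (p.eval G s),
        (idx.map NatExpr.cost).sum + p.cost + 1)
  | seq c c', s =>
      let r := c.exec G s
      let r' := c'.exec G r.1
      (r'.1, r.2 + r'.2)
  | ifLt e f c c', s =>
      let r := if e.eval s < f.eval s then c.exec G s else c'.exec G s
      (r.1, e.cost + f.cost + 1 + r.2)
  | loop v e c, s =>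
      (List.range (e.eval s)).foldl
        (fun r i =>
          let r' := c.exec G (r.1.setVar v i)
          (r'.1, r.2 + 1 + r'.2))
        (s, e.cost + 1)

/-- The initial store: the variables `0`, `1`, `2` hold the truncation level and the lengths of the
two sequences, and everything else is zero. -/
def initStore (M Lx Ly : ℕ) : Store where
  vars v := if v = 0 then M else if v = 1 then Lx else if v = 2 then Ly else 0
  cells _ _ := 0

/-- A real `Lx × Ly` matrix as the data of a program; entries out of range read as zero. -/
def matrixData {Lx Ly : ℕ} (G : Fin Lx → Fin Ly → ℝ) (i j : ℕ) : ℝ :=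
  if h : i < Lx ∧ j < Ly then G ⟨i, h.1⟩ ⟨j, h.2⟩ else 0

/-- The output of a program on truncation level `M` and matrix `G`: the content of the array `0` at
the empty tuple of indices after execution. -/
noncomputable def Program.output (P : Program) (M : ℕ) {Lx Ly : ℕ} (G : Fin Lx → Fin Ly → ℝ) : ℝ :=
  (P.exec (matrixData G) (initStore M Lx Ly)).1.cells 0 []

/-- The number of steps of a program on truncation level `M` and matrix `G`. -/
noncomputable def Program.steps (P : Program) (M : ℕ) {Lx Ly : ℕ} (G : Fin Lx → Fin Ly → ℝ) : ℕ :=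
  (P.exec (matrixData G) (initStore M Lx Ly)).2

end RealProgram

/-! Along a segment with increment `u`, the signature of a path is multiplied by `exp u` (Chen). Let
`S_i` and `T_j` be the signatures of the two piecewise linear paths up to times `i` and `j`, with
degree `n` parts `S_i^n` and `T_j^n`, and let `u_i` and `v_j` be the increments of the paths over
the unit intervals after these times. The numbers
`f i j m p q = ⟪S_i^{m-p} ⊗ u_i^{⊗p} / p!, T_j^{m-q} ⊗ v_j^{⊗q} / q!⟫` then satisfy

* `f i j (m+1) (p+1) (q+1) = ⟪u_i, v_j⟫ f i j m p q / ((p+1) (q+1))`, where `⟪u_i, v_j⟫` is a mixed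
  second difference of the Gram matrix;
* `f (i+1) j m 0 q = ∑_{p ≤ m} f i j m p q` and `f i (j+1) m p 0 = ∑_{q ≤ m} f i j m p q`.

If the partial sums over `p` and over `q` are maintained along with the entries, each of the
`(M + 1) ^ 3 Lx Ly` entries costs a bounded number of steps. The signature kernel is the sum over
`m` of the entries with `p = q = 0` at the end points of the two paths. -/

section Signature

open MeasureTheory Set

variable {H : Type} [NormedAddCommGroup H] [InnerProductSpace ℝ H]

/-! ### Iterated integrals along a segment -/

theorem inner_tensorSnoc {m : ℕ} (a b : (tensorPow H m).carrier) (u v : H) :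
    inner ℝ (tensorSnoc a u) (tensorSnoc b v) = inner ℝ a b * inner ℝ u v :=
  (UniformSpace.Completion.inner_coe _ _).trans (TensorProduct.inner_tmul ..)

/-- The map `a ↦ a ⊗ u` from `H^{⊗m}` to `H^{⊗(m+1)}`. -/
noncomputable def tensorSnocₗ (m : ℕ) (u : H) :
    (tensorPow H m).carrier →ₗ[ℝ] (tensorPow H (m + 1)).carrier :=
  (UniformSpace.Completion.toComplₗᵢ (𝕜 := ℝ)
    (E := (tensorPow H m).carrier ⊗[ℝ] H)).toLinearMap ∘ₗ
      (TensorProduct.mk ℝ (tensorPow H m).carrier H).flip u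

theorem tensorSnocₗ_apply {m : ℕ} (a : (tensorPow H m).carrier) (u : H) :
    tensorSnocₗ m u a = tensorSnoc a u := rfl

/-- The degree `m` part of `S ⊗ u^{⊗p} / p!`, for a sequence `S` of tensors. -/
noncomputable def tensorExpTerm (S : (m : ℕ) → (tensorPow H m).carrier) (u : H) :
    (m p : ℕ) → (tensorPow H m).carrier
  | m, 0 => S m
  | 0, _ + 1 => 0
  | m + 1, p + 1 => ((p : ℝ) + 1)⁻¹ • tensorSnoc (tensorExpTerm S u m p) u

theorem tensorExpTerm_zero_right (S : (m : ℕ) → (tensorPow H m).carrier) (u : H) (m : ℕ) :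
    tensorExpTerm S u m 0 = S m := by
  cases m <;> rfl

theorem tensorExpTerm_zero_left (S : (m : ℕ) → (tensorPow H m).carrier) (u : H) {p : ℕ}
    (hp : 0 < p) : tensorExpTerm S u 0 p = 0 := by
  obtain ⟨p, rfl⟩ := Nat.exists_eq_succ_of_ne_zero hp.ne'
  rfl

theorem tensorExpTerm_succ_succ (S : (m : ℕ) → (tensorPow H m).carrier) (u : H) (m p : ℕ) :
    tensorExpTerm S u (m + 1) (p + 1) =
      ((p : ℝ) + 1)⁻¹ • tensorSnoc (tensorExpTerm S u m p) u := rfl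

/-- The degree `m` part of `S ⊗ exp (τ u)`, for a sequence `S` of tensors. -/
noncomputable def tensorMulExp (S : (m : ℕ) → (tensorPow H m).carrier) (u : H) (m : ℕ) (τ : ℝ) :
    (tensorPow H m).carrier :=
  ∑ p ∈ Finset.range (m + 1), τ ^ p • tensorExpTerm S u m p

theorem tensorMulExp_zero (S : (m : ℕ) → (tensorPow H m).carrier) (u : H) (τ : ℝ) :
    tensorMulExp S u 0 τ = S 0 := by
  rw [tensorMulExp, Finset.sum_range_one, pow_zero, one_smul, tensorExpTerm_zero_right]

theorem tensorMulExp_one_right (S : (m : ℕ) → (tensorPow H m).carrier) (u : H) (m : ℕ) :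
    tensorMulExp S u m 1 = ∑ p ∈ Finset.range (m + 1), tensorExpTerm S u m p := by
  simp only [tensorMulExp, one_pow, one_smul]

theorem tensorSnoc_tensorMulExp (S : (m : ℕ) → (tensorPow H m).carrier) (u : H) (m : ℕ) (τ : ℝ) :
    tensorSnoc (tensorMulExp S u m τ) u =
      ∑ p ∈ Finset.range (m + 1), τ ^ p • tensorSnoc (tensorExpTerm S u m p) u := by
  simp only [tensorMulExp, ← tensorSnocₗ_apply, map_sum, map_smul]

theorem continuous_tensorSnoc_tensorMulExp (S : (m : ℕ) → (tensorPow H m).carrier) (u : H)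
    (m : ℕ) : Continuous fun τ => tensorSnoc (tensorMulExp S u m τ) u := by
  simp only [tensorSnoc_tensorMulExp]
  fun_prop

theorem tensorMulExp_succ_eq_add_integral (S : (m : ℕ) → (tensorPow H m).carrier) (u : H)
    (m : ℕ) (τ : ℝ) :
    tensorMulExp S u (m + 1) τ =
      S (m + 1) + ∫ s in (0 : ℝ)..τ, tensorSnoc (tensorMulExp S u m s) u := by
  have hterm (p : ℕ) : ∫ s in (0 : ℝ)..τ, s ^ p • tensorSnoc (tensorExpTerm S u m p) u =
      τ ^ (p + 1) • tensorExpTerm S u (m + 1) (p + 1) := by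
    rw [intervalIntegral.integral_smul_const, integral_pow, tensorExpTerm_succ_succ, smul_smul,
      zero_pow p.succ_ne_zero, sub_zero, div_eq_mul_inv]
  simp only [tensorSnoc_tensorMulExp]
  rw [intervalIntegral.integral_finsetSum fun p _ =>
    Continuous.intervalIntegrable (by fun_prop) _ _]
  simp only [hterm]
  rw [tensorMulExp, Finset.sum_range_succ', pow_zero, one_smul, tensorExpTerm_zero_right,
    add_comm (S (m + 1))]

theorem iteratedIntegral_succ (γ : ℝ → H) (m : ℕ) (t : ℝ) :
    iteratedIntegral γ (m + 1) t =
      ∫ s in (0 : ℝ)..t, tensorSnoc (iteratedIntegral γ m s) (deriv γ s) := rfl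

theorem iteratedIntegral_succ_zero (γ : ℝ → H) (m : ℕ) : iteratedIntegral γ (m + 1) 0 = 0 := by
  rw [iteratedIntegral_succ, intervalIntegral.integral_same]

section Segment

variable {γ : ℝ → H} {a b : ℝ} {u : H} {m : ℕ} {S : (m : ℕ) → (tensorPow H m).carrier}

theorem eqOn_tensorSnoc_tensorMulExp (hu : ∀ s ∈ Ioo a b, deriv γ s = u)
    (hm : ∀ s ∈ Ioo a b, iteratedIntegral γ m s = tensorMulExp S u m (s - a)) :
    EqOn (fun s => tensorSnoc (tensorMulExp S u m (s - a)) u)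
      (fun s => tensorSnoc (iteratedIntegral γ m s) (deriv γ s)) (Ioo a b) := by
  intro s hs
  simp only [hu s hs, hm s hs]

theorem intervalIntegrable_tensorSnoc_deriv (hu : ∀ s ∈ Ioo a b, deriv γ s = u)
    (hm : ∀ s ∈ Ioo a b, iteratedIntegral γ m s = tensorMulExp S u m (s - a)) (hab : a ≤ b) :
    IntervalIntegrable (fun s => tensorSnoc (iteratedIntegral γ m s) (deriv γ s)) volume a b := by
  have hcont : Continuous fun s => tensorSnoc (tensorMulExp S u m (s - a)) u :=
    (continuous_tensorSnoc_tensorMulExp S u m).comp (continuous_sub_right a)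
  refine (hcont.intervalIntegrable a b).congr_uIoo ?_
  rw [uIoo_of_le hab]
  exact eqOn_tensorSnoc_tensorMulExp hu hm

theorem integral_tensorSnoc_deriv (hu : ∀ s ∈ Ioo a b, deriv γ s = u)
    (hm : ∀ s ∈ Ioo a b, iteratedIntegral γ m s = tensorMulExp S u m (s - a)) (hab : a ≤ b) :
    ∫ s in a..b, tensorSnoc (iteratedIntegral γ m s) (deriv γ s) =
      ∫ s in (0 : ℝ)..(b - a), tensorSnoc (tensorMulExp S u m s) u := by
  rw [← intervalIntegral.integral_congr_Ioo_of_le hab (eqOn_tensorSnoc_tensorMulExp hu hm),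
    intervalIntegral.integral_comp_sub_right (fun s => tensorSnoc (tensorMulExp S u m s) u),
    sub_self]

/-- Chen's identity for a segment. -/
theorem iteratedIntegral_eq_tensorMulExp
    (hint : ∀ n, IntervalIntegrable
      (fun s => tensorSnoc (iteratedIntegral γ n s) (deriv γ s)) volume 0 a)
    (hu : ∀ s ∈ Ioo a b, deriv γ s = u) (m : ℕ) {t : ℝ} (ht : t ∈ Icc a b) :
    iteratedIntegral γ m t = tensorMulExp (fun n => iteratedIntegral γ n a) u m (t - a) := by
  induction m generalizing t with
  | zero => rw [tensorMulExp_zero]; rfl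
  | succ m ih =>
    have hu' : ∀ s ∈ Ioo a t, deriv γ s = u := fun s hs => hu s ⟨hs.1, hs.2.trans_le ht.2⟩
    have hm : ∀ s ∈ Ioo a t, iteratedIntegral γ m s =
        tensorMulExp (fun n => iteratedIntegral γ n a) u m (s - a) :=
      fun s hs => ih ⟨hs.1.le, hs.2.le.trans ht.2⟩
    rw [tensorMulExp_succ_eq_add_integral, ← integral_tensorSnoc_deriv hu' hm ht.1,
      iteratedIntegral_succ, iteratedIntegral_succ,
      intervalIntegral.integral_add_adjacent_intervals (hint m)
        (intervalIntegrable_tensorSnoc_deriv hu' hm ht.1)]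

end Segment

/-! ### Piecewise linear paths -/

/-- The path `γ` is linear over `[i, i + 1]` for every natural number `i`, as far as its velocity
goes: it is the increment of `γ` in the interior of the interval. -/
def IsLinearBetweenNats (γ : ℝ → H) : Prop :=
  ∀ (i : ℕ), ∀ s ∈ Ioo (i : ℝ) (i + 1), deriv γ s = γ (i + 1) - γ i

namespace IsLinearBetweenNats

variable {γ : ℝ → H}

theorem intervalIntegrable (hγ : IsLinearBetweenNats γ) (i m : ℕ) :
    IntervalIntegrable (fun s => tensorSnoc (iteratedIntegral γ m s) (deriv γ s)) volume 0 i := by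
  induction i generalizing m with
  | zero => simp
  | succ i ih =>
    rw [Nat.cast_succ]
    exact (ih m).trans <| intervalIntegrable_tensorSnoc_deriv (hγ i)
      (fun s hs => iteratedIntegral_eq_tensorMulExp ih (hγ i) m (Ioo_subset_Icc_self hs))
      (by linarith)

theorem iteratedIntegral_add_one (hγ : IsLinearBetweenNats γ) (i m : ℕ) :
    iteratedIntegral γ m (i + 1) = ∑ p ∈ Finset.range (m + 1),
      tensorExpTerm (fun n => iteratedIntegral γ n i) (γ (i + 1) - γ i) m p := by
  rw [iteratedIntegral_eq_tensorMulExp (hγ.intervalIntegrable i) (hγ i) m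
    (right_mem_Icc.2 (by linarith)), add_sub_cancel_left, tensorMulExp_one_right]

end IsLinearBetweenNats

theorem piecewiseLinear_natCast {L : ℕ} (v : Fin L → H) (i : ℕ) :
    piecewiseLinear v i = if h : i < L then v ⟨i, h⟩ else 0 := by
  simp [piecewiseLinear]

theorem piecewiseLinear_eq_of_mem_Ico {L : ℕ} (v : Fin L → H) {i : ℕ} {t : ℝ}
    (ht : t ∈ Ico (i : ℝ) (i + 1)) :
    piecewiseLinear v t = (1 - (t - i)) • piecewiseLinear v i +
      (t - i) • piecewiseLinear v (i + 1) := by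
  have hfloor : ⌊t⌋₊ = i := (Nat.floor_eq_iff (i.cast_nonneg.trans ht.1)).2 ht
  rw [← Nat.cast_succ, piecewiseLinear_natCast, piecewiseLinear_natCast, piecewiseLinear]
  simp only [hfloor]

theorem isLinearBetweenNats_piecewiseLinear {L : ℕ} (v : Fin L → H) :
    IsLinearBetweenNats (piecewiseLinear v) := by
  intro i s hs
  have hlocal : piecewiseLinear v =ᶠ[nhds s] fun t =>
      (1 - (t - i)) • piecewiseLinear v i + (t - i) • piecewiseLinear v (i + 1) := by
    filter_upwards [isOpen_Ioo.mem_nhds hs] with t ht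
    exact piecewiseLinear_eq_of_mem_Ico v (Ioo_subset_Ico_self ht)
  have hsub : HasDerivAt (fun t : ℝ => t - i) 1 s := (hasDerivAt_id s).sub_const _
  have hderiv := ((hsub.const_sub 1).smul_const (piecewiseLinear v i)).add
    (hsub.smul_const (piecewiseLinear v (i + 1)))
  rw [hlocal.deriv_eq]
  exact hderiv.deriv.trans (by module)

/-! ### The table of inner products -/

/-- The mixed second difference of a matrix. -/
def mixedDiff (G : ℕ → ℕ → ℝ) (i j : ℕ) : ℝ :=
  G (i + 1) (j + 1) - G (i + 1) j - G i (j + 1) + G i j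

/-- The recurrences of the inner products
`⟪S_i^{m-p} ⊗ u_i^{⊗p} / p!, T_j^{m-q} ⊗ v_j^{⊗q} / q!⟫`, indexed by `i`, `j`, `m`, `p`, `q`, where
`S_i` and `T_j` are the signatures up to times `i` and `j` of two piecewise linear paths whose
increments there are `u_i` and `v_j`, and `G` is the matrix of the inner products of their
vertices. -/
structure IsSigTable (G : ℕ → ℕ → ℝ) (f : ℕ → ℕ → ℕ → ℕ → ℕ → ℝ) : Prop where
  degree_zero (i j : ℕ) : f i j 0 0 0 = 1
  degree_zero_of_pos (i j : ℕ) {p q : ℕ} (h : 0 < p + q) : f i j 0 p q = 0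
  succ (i j m p q : ℕ) : f i j (m + 1) (p + 1) (q + 1) =
    mixedDiff G i j * f i j m p q / ((p + 1 : ℕ) : ℝ) / ((q + 1 : ℕ) : ℝ)
  left_zero (j m q : ℕ) : f 0 j (m + 1) 0 q = 0
  right_zero (i m p : ℕ) : f i 0 (m + 1) p 0 = 0
  left_succ (i j m q : ℕ) : f (i + 1) j m 0 q = ∑ p ∈ Finset.range (m + 1), f i j m p q
  right_succ (i j m p : ℕ) : f i (j + 1) m p 0 = ∑ q ∈ Finset.range (m + 1), f i j m p q

/-- The degree `m` part of `S_i ⊗ (γ (i + 1) - γ i)^{⊗p} / p!`, where `S_i` is the signature of `γ`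
on `[0, i]`. -/
noncomputable def segmentTerm (γ : ℝ → H) (i m p : ℕ) : (tensorPow H m).carrier :=
  tensorExpTerm (fun n => iteratedIntegral γ n i) (γ (i + 1) - γ i) m p

theorem segmentTerm_zero_right (γ : ℝ → H) (i m : ℕ) :
    segmentTerm γ i m 0 = iteratedIntegral γ m i :=
  tensorExpTerm_zero_right _ _ m

theorem segmentTerm_zero_succ_zero (γ : ℝ → H) (m : ℕ) : segmentTerm γ 0 (m + 1) 0 = 0 := by
  rw [segmentTerm_zero_right, Nat.cast_zero, iteratedIntegral_succ_zero]

theorem IsLinearBetweenNats.segmentTerm_succ {γ : ℝ → H} (hγ : IsLinearBetweenNats γ)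
    (i m : ℕ) :
    segmentTerm γ (i + 1) m 0 = ∑ p ∈ Finset.range (m + 1), segmentTerm γ i m p := by
  rw [segmentTerm_zero_right, Nat.cast_succ, hγ.iteratedIntegral_add_one]
  rfl

theorem inner_segmentTerm_succ (γ η : ℝ → H) (i j m p q : ℕ) :
    inner ℝ (segmentTerm γ i (m + 1) (p + 1)) (segmentTerm η j (m + 1) (q + 1)) =
      mixedDiff (fun i j => inner ℝ (γ i) (η j)) i j *
        inner ℝ (segmentTerm γ i m p) (segmentTerm η j m q) /
          ((p + 1 : ℕ) : ℝ) / ((q + 1 : ℕ) : ℝ) := by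
  have hincr : inner ℝ (γ (i + 1) - γ i) (η (j + 1) - η j) =
      mixedDiff (fun i j => inner ℝ (γ i) (η j)) i j := by
    simp only [mixedDiff, inner_sub_left, inner_sub_right, Nat.cast_succ]
    ring
  rw [segmentTerm, segmentTerm, tensorExpTerm_succ_succ, tensorExpTerm_succ_succ,
    real_inner_smul_left, real_inner_smul_right, inner_tensorSnoc, hincr]
  simp only [segmentTerm]
  push_cast
  ring

theorem isSigTable_inner_segmentTerm {γ η : ℝ → H} (hγ : IsLinearBetweenNats γ)
    (hη : IsLinearBetweenNats η) :
    IsSigTable (fun i j => inner ℝ (γ i) (η j))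
      fun i j m p q => inner ℝ (segmentTerm γ i m p) (segmentTerm η j m q) where
  degree_zero _ _ := by
    have h : inner ℝ (1 : ℝ) (1 : ℝ) = 1 := by simp
    exact h
  degree_zero_of_pos i j p q h := by
    rcases Nat.add_pos_iff_pos_or_pos.1 h with hp | hq
    · rw [segmentTerm, tensorExpTerm_zero_left _ _ hp, inner_zero_left]
    · rw [segmentTerm, segmentTerm, tensorExpTerm_zero_left _ _ hq, inner_zero_right]
  succ := inner_segmentTerm_succ γ η
  left_zero j m q := by rw [segmentTerm_zero_succ_zero, inner_zero_left]
  right_zero i m p := by rw [segmentTerm_zero_succ_zero, inner_zero_right]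
  left_succ i j m q := by rw [hγ.segmentTerm_succ, sum_inner]
  right_succ i j m p := by rw [hη.segmentTerm_succ, inner_sum]

theorem tensorInner_truncSignature (M : ℕ) (S T : ℝ) (γ η : ℝ → H) :
    tensorInner (truncSignature M S γ) (truncSignature M T η) =
      ∑ m ∈ Finset.range (M + 1), inner ℝ (iteratedIntegral γ m S) (iteratedIntegral η m T) := by
  rw [tensorInner, tsum_eq_sum (s := Finset.range (M + 1))]
  · refine Finset.sum_congr rfl fun m hm => ?_
    simp only [truncSignature, if_pos (Finset.mem_range_succ_iff.1 hm)]
  · intro m hm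
    simp only [truncSignature, if_neg (mt Finset.mem_range_succ_iff.2 hm), inner_zero_left]

theorem inner_piecewiseLinear_natCast {Lx Ly : ℕ} (v : Fin Lx → H) (w : Fin Ly → H) (i j : ℕ) :
    inner ℝ (piecewiseLinear v i) (piecewiseLinear w j) =
      RealProgram.matrixData (fun i j => inner ℝ (v i) (w j)) i j := by
  rw [piecewiseLinear_natCast, piecewiseLinear_natCast, RealProgram.matrixData]
  by_cases hi : i < Lx <;> by_cases hj : j < Ly <;> simp [hi, hj]

end Signature

theorem inner_kernelFeature {X : Type} (k : X → X → ℝ) [Fact (kernelMatrix k).PosSemidef]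
    (x y : X) : inner ℝ (kernelFeature k x) (kernelFeature k y) = k x y := by
  rw [kernelFeature, kernelFeature, RKHS.kerFun_inner, RKHS.kerFun_apply,
    RKHS.OfKernel.kernel_ofKernel]
  simp [kernelMatrix]

namespace RealProgram

/-! ### Reasoning about programs -/

/-- The variables which occur in an index expression. -/
def NatExpr.vars : NatExpr → Finset ℕ
  | lit _ => ∅
  | var v => {v}
  | add e f => e.vars ∪ f.vars
  | sub e f => e.vars ∪ f.vars

/-- The variables which a program may modify. -/
def Program.assignedVars : Program → Finset ℕ
  | skip => ∅
  | setVar v _ => {v}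
  | setCell _ _ _ => ∅
  | seq c c' => c.assignedVars ∪ c'.assignedVars
  | ifLt _ _ c c' => c.assignedVars ∪ c'.assignedVars
  | loop v _ c => insert v c.assignedVars

/-- The variables on which the numbers of iterations of the loops of a program depend. -/
def Program.loopBoundVars : Program → Finset ℕ
  | skip => ∅
  | setVar _ _ => ∅
  | setCell _ _ _ => ∅
  | seq c c' => c.loopBoundVars ∪ c'.loopBoundVars
  | ifLt _ _ c c' => c.loopBoundVars ∪ c'.loopBoundVars
  | loop _ e c => e.vars ∪ c.loopBoundVars

/-- The number of steps of a program, with all loop bounds evaluated in the store `s` and the more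
expensive branch taken at each test. It bounds the true number of steps if the program does not
modify its loop bounds. -/
def Program.costBound (s : Store) : Program → ℕ
  | skip => 1
  | setVar _ e => e.cost + 1
  | setCell _ idx p => (idx.map NatExpr.cost).sum + p.cost + 1
  | seq c c' => c.costBound s + c'.costBound s
  | ifLt e f c c' => e.cost + f.cost + 1 + max (c.costBound s) (c'.costBound s)
  | loop _ e c => e.cost + 1 + e.eval s * (c.costBound s + 1)

theorem NatExpr.eval_congr {s t : Store} {e : NatExpr} (h : ∀ w ∈ e.vars, s.vars w = t.vars w) :
    e.eval s = e.eval t := by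
  induction e with
  | lit n => rfl
  | var v => exact h v (Finset.mem_singleton_self v)
  | add e f ihe ihf | sub e f ihe ihf =>
    rw [eval, eval, ihe fun w hw => h w (Finset.mem_union_left _ hw),
      ihf fun w hw => h w (Finset.mem_union_right _ hw)]

theorem Program.costBound_congr {s t : Store} {c : Program}
    (h : ∀ w ∈ c.loopBoundVars, s.vars w = t.vars w) : c.costBound s = c.costBound t := by
  induction c with
  | skip | setVar | setCell => rfl
  | seq c c' ih ih' | ifLt _ _ c c' ih ih' =>
    rw [costBound, costBound, ih fun w hw => h w (Finset.mem_union_left _ hw),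
      ih' fun w hw => h w (Finset.mem_union_right _ hw)]
  | loop v e c ih =>
    rw [costBound, costBound, ih fun w hw => h w (Finset.mem_union_right _ hw),
      NatExpr.eval_congr fun w hw => h w (Finset.mem_union_left _ hw)]

theorem foldl_range_induction {α : Type*} {op : α → ℕ → α} {Inv : ℕ → α → Prop} {a : α} {n : ℕ}
    (h0 : Inv 0 a) (hstep : ∀ i < n, ∀ b, Inv i b → Inv (i + 1) (op b i)) :
    Inv n ((List.range n).foldl op a) := by
  induction n with
  | zero => exact h0
  | succ n ih =>
    rw [List.range_succ, List.foldl_append]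
    exact hstep n n.lt_succ_self _ (ih fun i hi => hstep i (hi.trans n.lt_succ_self))

variable {G : ℕ → ℕ → ℝ} {s : Store}

theorem Store.setVar_vars_of_ne {v w : ℕ} (h : w ≠ v) (n : ℕ) :
    (s.setVar v n).vars w = s.vars w := by
  simp [setVar, h]

theorem Program.exec_seq_fst (c c' : Program) :
    ((seq c c').exec G s).1 = (c'.exec G (c.exec G s).1).1 := rfl

theorem Program.exec_vars_of_notMem {c : Program} {w : ℕ} (hw : w ∉ c.assignedVars) :
    (c.exec G s).1.vars w = s.vars w := by
  induction c generalizing s with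
  | skip | setCell => rfl
  | setVar v e => exact Store.setVar_vars_of_ne (by simpa [assignedVars] using hw) _
  | seq c c' ih ih' =>
    rw [assignedVars, Finset.notMem_union] at hw
    rw [exec_seq_fst, ih' hw.2, ih hw.1]
  | ifLt e f c c' ih ih' =>
    rw [assignedVars, Finset.notMem_union] at hw
    simp only [exec]
    split_ifs
    exacts [ih hw.1, ih' hw.2]
  | loop v e c ih =>
    rw [assignedVars, Finset.mem_insert, not_or] at hw
    refine foldl_range_induction (Inv := fun _ (r : Store × ℕ) => r.1.vars w = s.vars w) rfl
      fun i _ r hr => ?_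
    rw [ih hw.2, Store.setVar_vars_of_ne hw.1, hr]

theorem Program.exec_loop_induction {v : ℕ} {e : NatExpr} {c : Program}
    {Inv : ℕ → (ℕ → List ℕ → ℝ) → Prop} (h0 : Inv 0 s.cells)
    (hstep : ∀ i < e.eval s, ∀ t : Store,
      (∀ w ∉ (loop v e c).assignedVars, t.vars w = s.vars w) → t.vars v = i →
        Inv i t.cells → Inv (i + 1) (c.exec G t).1.cells) :
    Inv (e.eval s) ((loop v e c).exec G s).1.cells := by
  suffices h : (∀ w ∉ (loop v e c).assignedVars, ((loop v e c).exec G s).1.vars w = s.vars w) ∧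
      Inv (e.eval s) ((loop v e c).exec G s).1.cells from h.2
  refine foldl_range_induction (Inv := fun i (r : Store × ℕ) =>
    (∀ w ∉ (loop v e c).assignedVars, r.1.vars w = s.vars w) ∧ Inv i r.1.cells)
    ⟨fun _ _ => rfl, h0⟩ fun i hi r ⟨hr, hInv⟩ => ?_
  have hvars : ∀ w ∉ (loop v e c).assignedVars, (r.1.setVar v i).vars w = s.vars w := by
    intro w hw
    have hne : w ≠ v := by rintro rfl; exact hw (Finset.mem_insert_self _ _)
    rw [Store.setVar_vars_of_ne hne, hr w hw]
  refine ⟨fun w hw => ?_, hstep i hi _ hvars (by simp [Store.setVar]) hInv⟩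
  rw [exec_vars_of_notMem fun h => hw (Finset.mem_insert_of_mem h), hvars w hw]

theorem Program.costBound_loop_le {v : ℕ} {e : NatExpr} {c : Program} {a N b X : ℕ}
    (hN : 0 < N) (hX : 0 < X) (he : e.eval s ≤ a * N) (hc : c.costBound s ≤ b * X) :
    (loop v e c).costBound s ≤ (e.cost + 1 + a * (b + 1)) * (N * X) :=
  calc e.cost + 1 + e.eval s * (c.costBound s + 1)
      ≤ (e.cost + 1) * (N * X) + a * N * (b * X + X) := by
        gcongr
        exacts [Nat.le_mul_of_pos_right _ (Nat.mul_pos hN hX), hX]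
    _ = (e.cost + 1 + a * (b + 1)) * (N * X) := by ring

theorem Program.exec_snd_le_costBound {c : Program}
    (hc : Disjoint c.loopBoundVars c.assignedVars) : (c.exec G s).2 ≤ c.costBound s := by
  induction c generalizing s with
  | skip | setVar | setCell => exact le_rfl
  | seq c c' ih ih' =>
    simp only [loopBoundVars, assignedVars, Finset.disjoint_union_left,
      Finset.disjoint_union_right] at hc
    have hcongr : c'.costBound (c.exec G s).1 = c'.costBound s := costBound_congr fun w hw =>
      exec_vars_of_notMem (Finset.disjoint_left.1 hc.1.2 hw)
    exact Nat.add_le_add (ih hc.1.1) ((ih' hc.2.2).trans_eq hcongr)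
  | ifLt e f c c' ih ih' =>
    simp only [loopBoundVars, assignedVars, Finset.disjoint_union_left,
      Finset.disjoint_union_right] at hc
    refine Nat.add_le_add_left ?_ _
    split_ifs
    exacts [(ih hc.1.1).trans (le_max_left _ _), (ih' hc.2.2).trans (le_max_right _ _)]
  | loop v e c ih =>
    have hloop : ∀ w ∈ c.loopBoundVars, w ≠ v ∧ w ∉ c.assignedVars := fun w hw => by
      simpa [assignedVars] using
        Finset.disjoint_left.1 hc (Finset.mem_union_right e.vars hw)
    have hdisj : Disjoint c.loopBoundVars c.assignedVars :=
      Finset.disjoint_left.2 fun w hw => (hloop w hw).2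
    refine (foldl_range_induction (Inv := fun i (r : Store × ℕ) =>
      (∀ w ∈ c.loopBoundVars, r.1.vars w = s.vars w) ∧
        r.2 ≤ e.cost + 1 + i * (c.costBound s + 1))
      ⟨fun _ _ => rfl, by simp⟩ fun i _ r hr => ?_).2
    have hvars : ∀ w ∈ c.loopBoundVars, (r.1.setVar v i).vars w = s.vars w := fun w hw => by
      rw [Store.setVar_vars_of_ne (hloop w hw).1, hr.1 w hw]
    refine ⟨fun w hw => (exec_vars_of_notMem (hloop w hw).2).trans (hvars w hw), ?_⟩
    have hbody := (ih hdisj (s := r.1.setVar v i)).trans_eq (costBound_congr hvars)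
    linarith [hr.2, add_one_mul i (c.costBound s + 1)]

/-! ### The program -/

/-- The indices `i`, `j`, `m`, `p`, `q` of the current entry of the table, held by the variables
`3, …, 7`. -/
abbrev iVar : NatExpr := .var 3
abbrev jVar : NatExpr := .var 4
abbrev mVar : NatExpr := .var 5
abbrev pVar : NatExpr := .var 6
abbrev qVar : NatExpr := .var 7

/-- The expression for the successor of the value of `e`. -/
abbrev NatExpr.succ (e : NatExpr) : NatExpr := e.add (lit 1)

/-- The expression for the (truncated) predecessor of the value of `e`. -/
abbrev NatExpr.pred (e : NatExpr) : NatExpr := e.sub (lit 1)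

/-- The mixed second difference of the data at `i`, `j`. -/
def mixedDiffExpr : RealExpr :=
  .add (.sub (.sub (.entry iVar.succ jVar.succ) (.entry iVar.succ jVar)) (.entry iVar jVar.succ))
    (.entry iVar jVar)

/-- Assignment to the current entry of the table, which is held by the array `1`. -/
def setEntry (r : RealExpr) : Program := .setCell 1 [iVar, jVar, mVar, pVar, qVar] r

/-- The computation of the current entry of the table by the recurrences of `IsSigTable`. The
arrays `2` and `3` hold the partial sums of the entries over `p` and over `q`. -/
def entryProgram : Program :=
  .ifLt mVar (.lit 1)
    (.ifLt (.add pVar qVar) (.lit 1)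
      (setEntry (.ofNat (.lit 1)))
      (setEntry (.ofNat (.lit 0)))) <|
  .ifLt pVar (.lit 1)
    (.ifLt iVar (.lit 1)
      (setEntry (.ofNat (.lit 0)))
      (setEntry (.cell 2 [iVar.pred, jVar, mVar, mVar.succ, qVar]))) <|
  .ifLt qVar (.lit 1)
    (.ifLt jVar (.lit 1)
      (setEntry (.ofNat (.lit 0)))
      (setEntry (.cell 3 [iVar, jVar.pred, mVar, pVar, mVar.succ]))) <|
  setEntry
    (.div (.div (.mul mixedDiffExpr (.cell 1 [iVar, jVar, mVar.pred, pVar.pred, qVar.pred]))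
      pVar) qVar)

/-- The addition of the current entry of the table to the partial sums. Their values for `n`
summands are at index `n`, so that every cell is assigned once. -/
def partialSumProgram : Program :=
  .seq
    (.setCell 2 [iVar, jVar, mVar, pVar.succ, qVar]
      (.add (.cell 2 [iVar, jVar, mVar, pVar, qVar]) (.cell 1 [iVar, jVar, mVar, pVar, qVar])))
    (.setCell 3 [iVar, jVar, mVar, pVar, qVar.succ]
      (.add (.cell 3 [iVar, jVar, mVar, pVar, qVar]) (.cell 1 [iVar, jVar, mVar, pVar, qVar])))

/-- The computation of the current entry of the table and of its two partial sums. -/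
def bodyProgram : Program := .seq entryProgram partialSumProgram

/-- The computation of the entries with given `i`, `j`, `m`, `p`. -/
def qLoop : Program := .loop 7 (NatExpr.var 0).succ bodyProgram

/-- The computation of the entries with given `i`, `j`, `m`. -/
def pLoop : Program := .loop 6 (NatExpr.var 0).succ qLoop

/-- The computation of the entries with given `i`, `j`. -/
def mLoop : Program := .loop 5 (NatExpr.var 0).succ pLoop

/-- The computation of the entries with given `i`. -/
def jLoop : Program := .loop 4 (.var 2) mLoop

/-- The computation of the entries with `i < Lx`, `j < Ly` and `m, p, q ≤ M`. -/
def tableProgram : Program := .loop 3 (.var 1) jLoop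

/-- The addition to the output of the entries with `i = Lx - 1`, `j = Ly - 1` and `p = q = 0`. -/
def resultProgram : Program :=
  .loop 5 (NatExpr.var 0).succ <|
    .setCell 0 [] <| .add (.cell 0 []) <|
      .cell 1 [(NatExpr.var 1).pred, (NatExpr.var 2).pred, mVar, .lit 0, .lit 0]

/-- The algorithm of the theorem. -/
def sigKernelProgram : Program := .seq tableProgram resultProgram

/-! ### Number of steps -/

theorem costBound_bodyProgram : bodyProgram.costBound s = 97 := by
  simp [bodyProgram, entryProgram, partialSumProgram, setEntry, mixedDiffExpr,
    Program.costBound, NatExpr.cost, RealExpr.cost]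

theorem costBound_resultProgram_le {N : ℕ} (hN : 0 < N) (hM : s.vars 0 + 1 ≤ 2 * N) :
    resultProgram.costBound s ≤ 32 * (N * 1) := by
  refine Program.costBound_loop_le (a := 2) (b := 13) hN one_pos hM ?_
  simp [Program.costBound, NatExpr.cost, RealExpr.cost]

theorem costBound_tableProgram_le {N L : ℕ} (hN : 0 < N) (hL : 0 < L)
    (hM : s.vars 0 + 1 ≤ 2 * N) (hx : s.vars 1 ≤ L) (hy : s.vars 2 ≤ L) :
    tableProgram.costBound s ≤ 824 * (L * (L * (N * (N * (N * 1))))) := by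
  have hq : qLoop.costBound s ≤ 200 * (N * 1) :=
    Program.costBound_loop_le (a := 2) (b := 97) hN one_pos hM costBound_bodyProgram.le
  have hp : pLoop.costBound s ≤ 406 * (N * (N * 1)) :=
    Program.costBound_loop_le (a := 2) (b := 200) hN (by positivity) hM hq
  have hm : mLoop.costBound s ≤ 818 * (N * (N * (N * 1))) :=
    Program.costBound_loop_le (a := 2) (b := 406) hN (by positivity) hM hp
  have hj : jLoop.costBound s ≤ 821 * (L * (N * (N * (N * 1)))) :=
    Program.costBound_loop_le (a := 1) (b := 818) hL (by positivity)
      (hy.trans_eq (one_mul L).symm) hm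
  exact Program.costBound_loop_le (a := 1) (b := 821) hL (by positivity)
    (hx.trans_eq (one_mul L).symm) hj

theorem steps_sigKernelProgram_le (M : ℕ) {Lx Ly : ℕ} (hx : 0 < Lx) (G : Fin Lx → Fin Ly → ℝ) :
    sigKernelProgram.steps M G ≤ 856 * max M 1 ^ 3 * max Lx Ly ^ 2 := by
  have hM : (initStore M Lx Ly).vars 0 + 1 ≤ 2 * max M 1 := by
    simp only [initStore, if_true]
    lia
  have hN : 0 < max M 1 := by lia
  have hL : 0 < max Lx Ly := by lia
  have htable := costBound_tableProgram_le hN hL hM (le_max_left Lx Ly) (le_max_right Lx Ly)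
  have hresult := costBound_resultProgram_le hN hM
  refine (Program.exec_snd_le_costBound (by decide)).trans
    ((Nat.add_le_add htable hresult).trans ?_)
  generalize max M 1 = N at hN
  generalize max Lx Ly = L at hL
  have hone : 1 ≤ N ^ 2 * L ^ 2 := Nat.succ_le_of_lt (by positivity)
  calc 824 * (L * (L * (N * (N * (N * 1))))) + 32 * (N * 1)
      ≤ 824 * (L * (L * (N * (N * (N * 1))))) + 32 * (N * (N ^ 2 * L ^ 2)) := by gcongr
    _ = 856 * N ^ 3 * L ^ 2 := by ring

/-! ### Correctness -/

/-- The entries of the table computed before that with indices `i`, `j`, `m`, `p`, `q`. -/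
def Before (M Ly i j m p q i₀ j₀ m₀ p₀ q₀ : ℕ) : Prop :=
  j₀ < Ly ∧ m₀ ≤ M ∧ p₀ ≤ M ∧ q₀ ≤ M ∧
    (i₀ < i ∨ i₀ = i ∧ (j₀ < j ∨ j₀ = j ∧ (m₀ < m ∨ m₀ = m ∧ (p₀ < p ∨ p₀ = p ∧ q₀ < q))))

/-- The state of the arrays in which the entries of the table `f` before `i`, `j`, `m`, `p`, `q`,
and their partial sums, have been computed, and no output has been produced yet. -/
structure Filled (f : ℕ → ℕ → ℕ → ℕ → ℕ → ℝ) (M Ly i j m p q : ℕ) (C : ℕ → List ℕ → ℝ) :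
    Prop where
  output : C 0 [] = 0
  entry {i₀ j₀ m₀ p₀ q₀ : ℕ} (h : Before M Ly i j m p q i₀ j₀ m₀ p₀ q₀) :
    C 1 [i₀, j₀, m₀, p₀, q₀] = f i₀ j₀ m₀ p₀ q₀
  leftSum_zero (i₀ j₀ m₀ q₀ : ℕ) : C 2 [i₀, j₀, m₀, 0, q₀] = 0
  leftSum {i₀ j₀ m₀ p₀ q₀ : ℕ} (h : Before M Ly i j m p q i₀ j₀ m₀ p₀ q₀) :
    C 2 [i₀, j₀, m₀, p₀ + 1, q₀] = ∑ r ∈ Finset.range (p₀ + 1), f i₀ j₀ m₀ r q₀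
  rightSum_zero (i₀ j₀ m₀ p₀ : ℕ) : C 3 [i₀, j₀, m₀, p₀, 0] = 0
  rightSum {i₀ j₀ m₀ p₀ q₀ : ℕ} (h : Before M Ly i j m p q i₀ j₀ m₀ p₀ q₀) :
    C 3 [i₀, j₀, m₀, p₀, q₀ + 1] = ∑ r ∈ Finset.range (q₀ + 1), f i₀ j₀ m₀ p₀ r

variable {f : ℕ → ℕ → ℕ → ℕ → ℕ → ℝ}

theorem Filled.of_before {C : ℕ → List ℕ → ℝ} {M Ly i j m p q i₁ j₁ m₁ p₁ q₁ : ℕ}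
    (h : Filled f M Ly i j m p q C)
    (hb : ∀ {i₀ j₀ m₀ p₀ q₀}, Before M Ly i₁ j₁ m₁ p₁ q₁ i₀ j₀ m₀ p₀ q₀ →
      Before M Ly i j m p q i₀ j₀ m₀ p₀ q₀) :
    Filled f M Ly i₁ j₁ m₁ p₁ q₁ C where
  output := h.output
  entry h₀ := h.entry (hb h₀)
  leftSum_zero := h.leftSum_zero
  leftSum h₀ := h.leftSum (hb h₀)
  rightSum_zero := h.rightSum_zero
  rightSum h₀ := h.rightSum (hb h₀)

theorem filled_initStore (M Lx Ly : ℕ) :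
    Filled f M Ly 0 0 0 0 0 (initStore M Lx Ly).cells := by
  constructor <;> simp [initStore, Before]

theorem Filled.setCell {M Ly i j m p q : ℕ} (h : Filled f M Ly i j m p q s.cells) :
    Filled f M Ly i j m p (q + 1)
      (((s.setCell 1 [i, j, m, p, q] (f i j m p q)).setCell 2 [i, j, m, p + 1, q]
        (∑ r ∈ Finset.range (p + 1), f i j m r q)).setCell 3 [i, j, m, p, q + 1]
          (∑ r ∈ Finset.range (q + 1), f i j m p r)).cells := by
  have hsucc {i₀ j₀ m₀ p₀ q₀ : ℕ} (h₀ : Before M Ly i j m p (q + 1) i₀ j₀ m₀ p₀ q₀) :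
      (i₀ = i ∧ j₀ = j ∧ m₀ = m ∧ p₀ = p ∧ q₀ = q) ∨
      (¬ (i₀ = i ∧ j₀ = j ∧ m₀ = m ∧ p₀ = p ∧ q₀ = q) ∧
        Before M Ly i j m p q i₀ j₀ m₀ p₀ q₀) := by
    unfold Before at *
    omega
  simp only [Store.setCell]
  constructor
  case output => simp [h.output]
  case entry =>
    intro i₀ j₀ m₀ p₀ q₀ h₀
    rcases hsucc h₀ with ⟨rfl, rfl, rfl, rfl, rfl⟩ | ⟨hne, h₀⟩
    · simp
    · simp [hne, h.entry h₀]
  case leftSum_zero => simp [h.leftSum_zero]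
  case leftSum =>
    intro i₀ j₀ m₀ p₀ q₀ h₀
    rcases hsucc h₀ with ⟨rfl, rfl, rfl, rfl, rfl⟩ | ⟨hne, h₀⟩
    · simp
    · simp [hne, h.leftSum h₀]
  case rightSum_zero => simp [h.rightSum_zero]
  case rightSum =>
    intro i₀ j₀ m₀ p₀ q₀ h₀
    rcases hsucc h₀ with ⟨rfl, rfl, rfl, rfl, rfl⟩ | ⟨hne, h₀⟩
    · simp
    · simp [hne, h.rightSum h₀]

theorem Filled.exec_entryProgram_fst (hf : IsSigTable G f)
    (h : Filled f (s.vars 0) (s.vars 2) (s.vars 3) (s.vars 4) (s.vars 5) (s.vars 6) (s.vars 7)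
      s.cells)
    (hj : s.vars 4 < s.vars 2) (hm : s.vars 5 ≤ s.vars 0) (hp : s.vars 6 ≤ s.vars 0)
    (hq : s.vars 7 ≤ s.vars 0) :
    (entryProgram.exec G s).1 =
      s.setCell 1 [s.vars 3, s.vars 4, s.vars 5, s.vars 6, s.vars 7]
        (f (s.vars 3) (s.vars 4) (s.vars 5) (s.vars 6) (s.vars 7)) := by
  simp only [entryProgram, setEntry, mixedDiffExpr, Program.exec, NatExpr.eval, RealExpr.eval,
    List.map_cons, List.map_nil]
  generalize s.vars 0 = M at *
  generalize s.vars 2 = Ly at *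
  generalize s.vars 3 = i at *
  generalize s.vars 4 = j at *
  generalize s.vars 5 = m at *
  generalize s.vars 6 = p at *
  generalize s.vars 7 = q at *
  rcases m with _ | m
  · rcases Nat.eq_zero_or_pos (p + q) with hpq | hpq
    · obtain ⟨rfl, rfl⟩ := Nat.add_eq_zero_iff.1 hpq
      simp [hf.degree_zero]
    · have hne : ¬ (p = 0 ∧ q = 0) := by omega
      simp [hne, hf.degree_zero_of_pos i j hpq]
  rcases p with _ | p
  · rcases i with _ | i
    · simp [hf.left_zero]
    · have hsum := h.leftSum (i₀ := i) (j₀ := j) (m₀ := m + 1) (p₀ := m + 1) (q₀ := q)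
        (by unfold Before; omega)
      simp [hf.left_succ, hsum]
  rcases q with _ | q
  · rcases j with _ | j
    · simp [hf.right_zero]
    · have hsum := h.rightSum (i₀ := i) (j₀ := j) (m₀ := m + 1) (p₀ := p + 1) (q₀ := m + 1)
        (by unfold Before; omega)
      simp [hf.right_succ, hsum]
  have hentry := h.entry (i₀ := i) (j₀ := j) (m₀ := m) (p₀ := p) (q₀ := q)
    (by unfold Before; omega)
  simp [hf.succ, hentry, mixedDiff]

theorem Filled.exec_bodyProgram (hf : IsSigTable G f)
    (h : Filled f (s.vars 0) (s.vars 2) (s.vars 3) (s.vars 4) (s.vars 5) (s.vars 6) (s.vars 7)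
      s.cells)
    (hj : s.vars 4 < s.vars 2) (hm : s.vars 5 ≤ s.vars 0) (hp : s.vars 6 ≤ s.vars 0)
    (hq : s.vars 7 ≤ s.vars 0) :
    Filled f (s.vars 0) (s.vars 2) (s.vars 3) (s.vars 4) (s.vars 5) (s.vars 6) (s.vars 7 + 1)
      (bodyProgram.exec G s).1.cells := by
  have hleft : s.cells 2 [s.vars 3, s.vars 4, s.vars 5, s.vars 6, s.vars 7] =
      ∑ r ∈ Finset.range (s.vars 6), f (s.vars 3) (s.vars 4) (s.vars 5) r (s.vars 7) := by
    cases hp₀ : s.vars 6 with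
    | zero => simp [h.leftSum_zero]
    | succ p => exact h.leftSum (by unfold Before; omega)
  have hright : s.cells 3 [s.vars 3, s.vars 4, s.vars 5, s.vars 6, s.vars 7] =
      ∑ r ∈ Finset.range (s.vars 7), f (s.vars 3) (s.vars 4) (s.vars 5) (s.vars 6) r := by
    cases hq₀ : s.vars 7 with
    | zero => simp [h.rightSum_zero]
    | succ q => exact h.rightSum (by unfold Before; omega)
  convert h.setCell using 2
  rw [bodyProgram, Program.exec_seq_fst, h.exec_entryProgram_fst hf hj hm hp hq]
  simp [partialSumProgram, Program.exec, NatExpr.eval, RealExpr.eval, Store.setCell, hleft, hright,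
    Finset.sum_range_succ]

theorem Filled.exec_qLoop (hf : IsSigTable G f)
    (h : Filled f (s.vars 0) (s.vars 2) (s.vars 3) (s.vars 4) (s.vars 5) (s.vars 6) 0 s.cells)
    (hj : s.vars 4 < s.vars 2) (hm : s.vars 5 ≤ s.vars 0) (hp : s.vars 6 ≤ s.vars 0) :
    Filled f (s.vars 0) (s.vars 2) (s.vars 3) (s.vars 4) (s.vars 5) (s.vars 6 + 1) 0
      (qLoop.exec G s).1.cells := by
  have hloop := Program.exec_loop_induction (G := G) (v := 7) (e := (NatExpr.var 0).succ)
    (c := bodyProgram)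
    (Inv := Filled f (s.vars 0) (s.vars 2) (s.vars 3) (s.vars 4) (s.vars 5) (s.vars 6)) h
    fun q hq t hvars hqt ht => by
      have hbody := Filled.exec_bodyProgram (s := t) hf
      simp only [hqt, hvars 0 (by decide), hvars 2 (by decide), hvars 3 (by decide),
        hvars 4 (by decide), hvars 5 (by decide), hvars 6 (by decide)] at hbody
      exact hbody ht hj hm hp (Nat.lt_succ_iff.1 hq)
  refine hloop.of_before fun h₀ => ?_
  simp only [Before, NatExpr.eval] at *
  omega

theorem Filled.exec_pLoop (hf : IsSigTable G f)
    (h : Filled f (s.vars 0) (s.vars 2) (s.vars 3) (s.vars 4) (s.vars 5) 0 0 s.cells)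
    (hj : s.vars 4 < s.vars 2) (hm : s.vars 5 ≤ s.vars 0) :
    Filled f (s.vars 0) (s.vars 2) (s.vars 3) (s.vars 4) (s.vars 5 + 1) 0 0
      (pLoop.exec G s).1.cells := by
  have hloop := Program.exec_loop_induction (G := G) (v := 6) (e := (NatExpr.var 0).succ)
    (c := qLoop)
    (Inv := fun p => Filled f (s.vars 0) (s.vars 2) (s.vars 3) (s.vars 4) (s.vars 5) p 0) h
    fun p hp t hvars hpt ht => by
      have hq := Filled.exec_qLoop (s := t) hf
      simp only [hpt, hvars 0 (by decide), hvars 2 (by decide), hvars 3 (by decide),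
        hvars 4 (by decide), hvars 5 (by decide)] at hq
      exact hq ht hj hm (Nat.lt_succ_iff.1 hp)
  refine hloop.of_before fun h₀ => ?_
  simp only [Before, NatExpr.eval] at *
  omega

theorem Filled.exec_mLoop (hf : IsSigTable G f)
    (h : Filled f (s.vars 0) (s.vars 2) (s.vars 3) (s.vars 4) 0 0 0 s.cells)
    (hj : s.vars 4 < s.vars 2) :
    Filled f (s.vars 0) (s.vars 2) (s.vars 3) (s.vars 4 + 1) 0 0 0
      (mLoop.exec G s).1.cells := by
  have hloop := Program.exec_loop_induction (G := G) (v := 5) (e := (NatExpr.var 0).succ)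
    (c := pLoop)
    (Inv := fun m => Filled f (s.vars 0) (s.vars 2) (s.vars 3) (s.vars 4) m 0 0) h
    fun m hm t hvars hmt ht => by
      have hp := Filled.exec_pLoop (s := t) hf
      simp only [hmt, hvars 0 (by decide), hvars 2 (by decide), hvars 3 (by decide),
        hvars 4 (by decide)] at hp
      exact hp ht hj (Nat.lt_succ_iff.1 hm)
  refine hloop.of_before fun h₀ => ?_
  simp only [Before, NatExpr.eval] at *
  omega

theorem Filled.exec_jLoop (hf : IsSigTable G f)
    (h : Filled f (s.vars 0) (s.vars 2) (s.vars 3) 0 0 0 0 s.cells) :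
    Filled f (s.vars 0) (s.vars 2) (s.vars 3 + 1) 0 0 0 0 (jLoop.exec G s).1.cells := by
  have hloop := Program.exec_loop_induction (G := G) (v := 4) (e := .var 2)
    (c := mLoop)
    (Inv := fun j => Filled f (s.vars 0) (s.vars 2) (s.vars 3) j 0 0 0) h
    fun j hj t hvars hjt ht => by
      have hm := Filled.exec_mLoop (s := t) hf
      simp only [hjt, hvars 0 (by decide), hvars 2 (by decide), hvars 3 (by decide)] at hm
      exact hm ht hj
  refine hloop.of_before fun h₀ => ?_
  simp only [Before, NatExpr.eval] at *
  omega

theorem Filled.exec_tableProgram (hf : IsSigTable G f)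
    (h : Filled f (s.vars 0) (s.vars 2) 0 0 0 0 0 s.cells) :
    Filled f (s.vars 0) (s.vars 2) (s.vars 1) 0 0 0 0 (tableProgram.exec G s).1.cells :=
  Program.exec_loop_induction (G := G) (v := 3) (e := .var 1) (c := jLoop)
    (Inv := fun i => Filled f (s.vars 0) (s.vars 2) i 0 0 0 0) h
    fun i _ t hvars hit ht => by
      have hj := Filled.exec_jLoop (s := t) hf
      simp only [hit, hvars 0 (by decide), hvars 2 (by decide)] at hj
      exact hj ht

theorem Filled.exec_resultProgram
    (h : Filled f (s.vars 0) (s.vars 2) (s.vars 1) 0 0 0 0 s.cells)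
    (hx : 0 < s.vars 1) (hy : 0 < s.vars 2) :
    (resultProgram.exec G s).1.cells 0 [] =
      ∑ m ∈ Finset.range (s.vars 0 + 1), f (s.vars 1 - 1) (s.vars 2 - 1) m 0 0 := by
  have hloop := Program.exec_loop_induction (G := G) (s := s) (v := 5)
    (e := (NatExpr.var 0).succ)
    (c := .setCell 0 [] <| .add (.cell 0 []) <|
      .cell 1 [(NatExpr.var 1).pred, (NatExpr.var 2).pred, mVar, .lit 0, .lit 0])
    (Inv := fun n C => C 1 = s.cells 1 ∧
      C 0 [] = ∑ m ∈ Finset.range n, f (s.vars 1 - 1) (s.vars 2 - 1) m 0 0)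
    ⟨rfl, h.output⟩ fun m hm t hvars hmt ⟨htable, hsum⟩ => by
      have hentry := h.entry (i₀ := s.vars 1 - 1) (j₀ := s.vars 2 - 1) (m₀ := m) (p₀ := 0)
        (q₀ := 0) (by simp only [Before, NatExpr.eval] at *; omega)
      simp [Program.exec, NatExpr.eval, RealExpr.eval, Store.setCell, htable, hsum, hentry, hmt,
        hvars 1 (by decide), hvars 2 (by decide), Finset.sum_range_succ]
  exact hloop.2

theorem output_sigKernelProgram (M : ℕ) {Lx Ly : ℕ} (hx : 0 < Lx) (hy : 0 < Ly)
    {G : Fin Lx → Fin Ly → ℝ} (hf : IsSigTable (matrixData G) f) :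
    sigKernelProgram.output M G =
      ∑ m ∈ Finset.range (M + 1), f (Lx - 1) (Ly - 1) m 0 0 := by
  have hvars (w : ℕ) (hw : w ∉ tableProgram.assignedVars) :
      (tableProgram.exec (matrixData G) (initStore M Lx Ly)).1.vars w =
        (initStore M Lx Ly).vars w := Program.exec_vars_of_notMem hw
  have htable := Filled.exec_tableProgram (s := initStore M Lx Ly) hf (filled_initStore M Lx Ly)
  rw [← hvars 0 (by decide), ← hvars 1 (by decide), ← hvars 2 (by decide)] at htable
  have hresult := htable.exec_resultProgram (G := matrixData G)
  rw [hvars 0 (by decide), hvars 1 (by decide), hvars 2 (by decide)] at hresult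
  exact hresult hx hy

end RealProgram

theorem output_sigKernelProgram_inner {H : Type} [NormedAddCommGroup H] [InnerProductSpace ℝ H]
    (M : ℕ) {Lx Ly : ℕ} (hx : 0 < Lx) (hy : 0 < Ly) (v : Fin Lx → H) (w : Fin Ly → H) :
    RealProgram.sigKernelProgram.output M (fun i j => inner ℝ (v i) (w j)) =
      tensorInner (truncSignature M ((Lx : ℝ) - 1) (piecewiseLinear v))
        (truncSignature M ((Ly : ℝ) - 1) (piecewiseLinear w)) := by
  have htable := isSigTable_inner_segmentTerm (isLinearBetweenNats_piecewiseLinear v)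
    (isLinearBetweenNats_piecewiseLinear w)
  simp only [inner_piecewiseLinear_natCast] at htable
  rw [RealProgram.output_sigKernelProgram M hx hy htable, tensorInner_truncSignature]
  simp only [segmentTerm_zero_right, Nat.cast_pred hx, Nat.cast_pred hy]

theorem mainTheorem3_general :
    ∃ (P : RealProgram.Program) (C : ℕ),
      ∀ (X : Type) (k : X → X → ℝ) (hk : IsPosDefKernel k) (M Lx Ly : ℕ), 1 ≤ Lx → 1 ≤ Ly →
        ∀ (x : Fin Lx → X) (y : Fin Ly → X),
          P.output M (fun i j => k (x i) (y j)) = truncSigKernel k hk M x y ∧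
          P.steps M (fun i j => k (x i) (y j)) ≤ C * (max M 1) ^ 3 * (max Lx Ly) ^ 2 := by
  refine ⟨RealProgram.sigKernelProgram, 856, fun X k hk M Lx Ly hx hy x y =>
    ⟨?_, RealProgram.steps_sigKernelProgram_le M hx _⟩⟩
  have : Fact (kernelMatrix k).PosSemidef := ⟨hk.posSemidef⟩
  simp only [truncSigKernel, ← output_sigKernelProgram_inner M hx hy, inner_kernelFeature]

theorem mainTheorem3 :
    ∃ (P : RealProgram.Program) (C : ℕ),
      ∀ (d : ℕ) (k : EuclideanSpace ℝ (Fin d) → EuclideanSpace ℝ (Fin d) → ℝ)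
        (hk : IsPosDefKernel k) (M Lx Ly : ℕ), 1 ≤ Lx → 1 ≤ Ly →
        ∀ (x : Fin Lx → EuclideanSpace ℝ (Fin d)) (y : Fin Ly → EuclideanSpace ℝ (Fin d)),
          P.output M (fun i j => k (x i) (y j)) = truncSigKernel k hk M x y ∧
          P.steps M (fun i j => k (x i) (y j)) ≤ C * (max M 1) ^ 3 * (max Lx Ly) ^ 2 := by
  obtain ⟨P, C, h⟩ := mainTheorem3_general
  exact ⟨P, C, fun d => h (EuclideanSpace ℝ (Fin d))⟩
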